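/- For $k\in\mathbb{N}\cup\{\omega\}$ let $F_k$ be the set of propositional formulas built from $k$ variables (countably infinitely many if $k=\omega$) with $\wedge,\vee,\rightarrow,\bot,\top$, and let $\vdash$ denote intuitionistic consequence. A function $f\colon F_m\to F_n$ is called *consequence-respecting* if for all nonempty $\Gamma\subseteq F_m$ and all $\varphi\in F_m$ one has $\Gamma\vdash\varphi$ if and only if $f(\Gamma)\vdash f(\varphi)$, where $f(\Gamma)=\{f(\gamma):\gamma\in\Gamma\}$; *tautology-respecting* if for all $\varphi\in F_m$ one has $\vdash\varphi$ if and only if $\vdash f(\varphi)$; and *$(\wedge,\vee)$-preserving* if $f(\varphi\wedge\psi)=f(\varphi)\wedge f(\psi)$ and $f(\varphi\vee\psi)=f(\varphi)\vee f(\psi)$ (identity of formulas) for all $\varphi,\psi\in F_m$. Let $m\in\mathbb{N}\cup\{\omega\}$ and let $n\ge 2$ be a natural number. Then: 1. there is a function $F_m\to F_n$ that is consequence-respecting, tautology-respecting and $(\wedge,\vee)$-preserving; 2. there is a function $F_m\to F_n$ that is consequence-respecting and $(\wedge,\vee)$-preserving but not tautology-respecting; 3. there is a function $F_m\to F_n$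 that is consequence-respecting and tautology-respecting. -/

import Mathlib

namespace IPC

/-- Propositional formulas over a type `V` of variables. -/
inductive Formula (V : Type) : Type where
  | var : V → Formula V
  | bot : Formula V
  | top : Formula V
  | and : Formula V → Formula V → Formula V
  | or : Formula V → Formula V → Formula V
  | imp : Formula V → Formula V → Formula V

/-- Intuitionistic consequence `Γ ⊢ φ`, given by natural deduction; `Γ` may be infinite.
The connective `¬φ` is understood as `φ → ⊥`. -/
inductive Proves {V : Type} : Set (Formula V) → Formula V → Prop where
  | ax {Γ : Set (Formula V)} {φ : Formula V} : φ ∈ Γ → Proves Γ φ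
  | topI {Γ : Set (Formula V)} : Proves Γ Formula.top
  | botE {Γ : Set (Formula V)} {φ : Formula V} : Proves Γ Formula.bot → Proves Γ φ
  | andI {Γ : Set (Formula V)} {φ ψ : Formula V} :
      Proves Γ φ → Proves Γ ψ → Proves Γ (Formula.and φ ψ)
  | andE₁ {Γ : Set (Formula V)} {φ ψ : Formula V} : Proves Γ (Formula.and φ ψ) → Proves Γ φ
  | andE₂ {Γ : Set (Formula V)} {φ ψ : Formula V} : Proves Γ (Formula.and φ ψ) → Proves Γ ψ
  | orI₁ {Γ : Set (Formula V)} {φ ψ : Formula V} : Proves Γ φ → Proves Γ (Formula.or φ ψ)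
  | orI₂ {Γ : Set (Formula V)} {φ ψ : Formula V} : Proves Γ ψ → Proves Γ (Formula.or φ ψ)
  | orE {Γ : Set (Formula V)} {φ ψ χ : Formula V} :
      Proves Γ (Formula.or φ ψ) → Proves (insert φ Γ) χ → Proves (insert ψ Γ) χ → Proves Γ χ
  | impI {Γ : Set (Formula V)} {φ ψ : Formula V} :
      Proves (insert φ Γ) ψ → Proves Γ (Formula.imp φ ψ)
  | impE {Γ : Set (Formula V)} {φ ψ : Formula V} :
      Proves Γ (Formula.imp φ ψ) → Proves Γ φ → Proves Γ ψ

/-- `φ` is an intuitionistic tautology: it is provable from no assumptions. -/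
def Tautology {V : Type} (φ : Formula V) : Prop := Proves ∅ φ

/-- The variables of `m`-variable logic, for `m` a natural number or `m = ω` (written `⊤`):
the natural numbers below `m`. -/
def Var (m : ℕ∞) : Type := {i : ℕ // (i : ℕ∞) < m}

/-- The set `F_m` of formulas of `m`-variable logic, for `m` a natural number or `m = ω`. -/
abbrev F (m : ℕ∞) : Type := Formula (Var m)

/-- For every nonempty `Γ` and every `φ`: `Γ ⊢ φ` iff `f(Γ) ⊢ f(φ)`. -/
def ConsequenceRespecting {V W : Type} (f : Formula V → Formula W) : Prop :=
  ∀ (Γ : Set (Formula V)) (φ : Formula V), Γ.Nonempty → (Proves Γ φ ↔ Proves (f '' Γ) (f φ))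

/-- For every `φ`: `⊢ φ` iff `⊢ f(φ)`. -/
def TautologyRespecting {V W : Type} (f : Formula V → Formula W) : Prop :=
  ∀ φ : Formula V, Tautology φ ↔ Tautology (f φ)

/-- `f` commutes with conjunction and disjunction, as an identity of formulas. -/
def AndOrPreserving {V W : Type} (f : Formula V → Formula W) : Prop :=
  ∀ φ ψ : Formula V,
    f (Formula.and φ ψ) = Formula.and (f φ) (f ψ) ∧ f (Formula.or φ ψ) = Formula.or (f φ) (f ψ)

end IPC

/-!
The logic with countably many variables is interpreted in the logic with two variables `p`, `q`
by a translation `translate` which sends `⊥` to `b = q ∨ (q → p)`, sends the `i`-th variable to a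
formula `A i` (up to adding `b` as a disjunct), and commutes with all other connectives. In
algebraic terms, the free Heyting algebra on countably many generators embeds into the interval
`[b, ⊤]` of the free Heyting algebra on two generators. To obtain also an embedding that moves the
top element, everything is met with a formula `t`: for `t = ⊤` tautologies are respected, for
`t = ¬¬(p ∨ q)` they are not.

That the translation preserves consequence is an induction on derivations (`Proves.translate`),
where `⊥`-elimination works because `b` entails every translated formula.

That it reflects consequence is shown with Kripke models (`forces_translate`). To a model `K` one
adds, above the worlds of `K`, worlds forcing `b`:
* the Rieger–Nishimura ladder `x 0, x 1, …`, where `x k` sees `x j` iff `j = k` or `j + 2 ≤ k`,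
  with `p` true everywhere and `q` only at `x 0`;
* for every variable `v` a world `c v` that forces neither `p` nor `q` and sees the first rungs
  `x 0, …, x (idx v)` of the ladder, where `idx` enumerates the variables;
* a maximal world `d` forcing `q` but not `p`.

A world `w` of `K` sees `d`, the whole ladder, and those `c v` for which `v` fails at `w`. The
worlds of `K` are then precisely those that do not force `b`, every initial segment of the ladder
is defined by a formula in `q`, and `A (idx v)` fails at `w` exactly if `w` sees `c v`. So a world
of `K` forces a formula iff it forces the translation. As intuitionistic logic is strongly
complete for Kripke models (`exists_countermodel`), a consequence that fails in the source also
fails after translation.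
-/

namespace IPC

/-! ### Weakening, compactness and completeness -/

theorem Proves.mono {V : Type} {Γ Δ : Set (Formula V)} {φ : Formula V} (h : Proves Γ φ)
    (hΓ : Γ ⊆ Δ) : Proves Δ φ := by
  induction h generalizing Δ with
  | ax h => exact .ax (hΓ h)
  | topI => exact .topI
  | botE _ ih => exact .botE (ih hΓ)
  | andI _ _ ih₁ ih₂ => exact .andI (ih₁ hΓ) (ih₂ hΓ)
  | andE₁ _ ih => exact .andE₁ (ih hΓ)
  | andE₂ _ ih => exact .andE₂ (ih hΓ)
  | orI₁ _ ih => exact .orI₁ (ih hΓ)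
  | orI₂ _ ih => exact .orI₂ (ih hΓ)
  | orE _ _ _ ih₁ ih₂ ih₃ =>
    exact .orE (ih₁ hΓ) (ih₂ (Set.insert_subset_insert hΓ)) (ih₃ (Set.insert_subset_insert hΓ))
  | impI _ ih => exact .impI (ih (Set.insert_subset_insert hΓ))
  | impE _ _ ih₁ ih₂ => exact .impE (ih₁ hΓ) (ih₂ hΓ)

theorem Proves.cut {V : Type} {Γ : Set (Formula V)} {φ ψ : Formula V} (h₁ : Proves Γ φ)
    (h₂ : Proves (insert φ Γ) ψ) : Proves Γ ψ :=
  .impE (.impI h₂) h₁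

theorem Proves.exists_finite {V : Type} {Γ : Set (Formula V)} {φ : Formula V} (h : Proves Γ φ) :
    ∃ Δ ⊆ Γ, Δ.Finite ∧ Proves Δ φ := by
  induction h with
  | @ax Γ φ h => exact ⟨{φ}, by simpa using h, Set.finite_singleton _, .ax rfl⟩
  | topI => exact ⟨∅, Set.empty_subset _, Set.finite_empty, .topI⟩
  | botE _ ih => obtain ⟨Δ, h, hf, hp⟩ := ih; exact ⟨Δ, h, hf, .botE hp⟩
  | andI _ _ ih₁ ih₂ =>
    obtain ⟨Δ₁, h₁, hf₁, hp₁⟩ := ih₁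
    obtain ⟨Δ₂, h₂, hf₂, hp₂⟩ := ih₂
    exact ⟨Δ₁ ∪ Δ₂, Set.union_subset h₁ h₂, hf₁.union hf₂,
      .andI (hp₁.mono Set.subset_union_left) (hp₂.mono Set.subset_union_right)⟩
  | andE₁ _ ih => obtain ⟨Δ, h, hf, hp⟩ := ih; exact ⟨Δ, h, hf, .andE₁ hp⟩
  | andE₂ _ ih => obtain ⟨Δ, h, hf, hp⟩ := ih; exact ⟨Δ, h, hf, .andE₂ hp⟩
  | orI₁ _ ih => obtain ⟨Δ, h, hf, hp⟩ := ih; exact ⟨Δ, h, hf, .orI₁ hp⟩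
  | orI₂ _ ih => obtain ⟨Δ, h, hf, hp⟩ := ih; exact ⟨Δ, h, hf, .orI₂ hp⟩
  | @orE Γ φ ψ χ _ _ _ ih₁ ih₂ ih₃ =>
    obtain ⟨Δ₁, h₁, hf₁, hp₁⟩ := ih₁
    obtain ⟨Δ₂, h₂, hf₂, hp₂⟩ := ih₂
    obtain ⟨Δ₃, h₃, hf₃, hp₃⟩ := ih₃
    refine ⟨Δ₁ ∪ (Δ₂ \ {φ} ∪ Δ₃ \ {ψ}), ?_, hf₁.union (hf₂.sdiff.union hf₃.sdiff),
      .orE (hp₁.mono Set.subset_union_left) (hp₂.mono ?_) (hp₃.mono ?_)⟩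
    · exact Set.union_subset h₁ (Set.union_subset (by simpa [Set.sdiff_subset_iff] using h₂)
        (by simpa [Set.sdiff_subset_iff] using h₃))
    · intro x hx
      by_cases h : x = φ <;> simp [h, hx]
    · intro x hx
      by_cases h : x = ψ <;> simp [h, hx]
  | @impI Γ φ ψ _ ih =>
    obtain ⟨Δ, h, hf, hp⟩ := ih
    refine ⟨Δ \ {φ}, by simpa [Set.sdiff_subset_iff] using h, hf.sdiff, .impI (hp.mono ?_)⟩
    intro x hx
    by_cases h : x = φ <;> simp [h, hx]
  | impE _ _ ih₁ ih₂ =>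
    obtain ⟨Δ₁, h₁, hf₁, hp₁⟩ := ih₁
    obtain ⟨Δ₂, h₂, hf₂, hp₂⟩ := ih₂
    exact ⟨Δ₁ ∪ Δ₂, Set.union_subset h₁ h₂, hf₁.union hf₂,
      .impE (hp₁.mono Set.subset_union_left) (hp₂.mono Set.subset_union_right)⟩

/-- Forcing in the Kripke model with set of worlds `W`, where `val v w` says that the variable `v`
is true at the world `w`. The worlds seen from `w` are those above `w`. -/
def Forces {V W : Type} [Preorder W] (val : V → W → Prop) : W → Formula V → Prop
  | w, .var v => val v w
  | _, .bot => False
  | _, .top => True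
  | w, .and φ ψ => Forces val w φ ∧ Forces val w ψ
  | w, .or φ ψ => Forces val w φ ∨ Forces val w ψ
  | w, .imp φ ψ => ∀ u, w ≤ u → Forces val u φ → Forces val u ψ

theorem Forces.mono {V W : Type} [Preorder W] {val : V → W → Prop} (hval : ∀ v, Monotone (val v))
    {φ : Formula V} {w u : W} (hwu : w ≤ u) (h : Forces val w φ) : Forces val u φ := by
  induction φ with
  | var v => exact hval v hwu h
  | bot => exact h
  | top => trivial
  | and φ ψ ih₁ ih₂ => exact ⟨ih₁ h.1, ih₂ h.2⟩
  | or φ ψ ih₁ ih₂ => exact h.imp ih₁ ih₂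
  | imp φ ψ _ _ => exact fun u' hu => h u' (hwu.trans hu)

theorem Proves.sound {V W : Type} [Preorder W] {val : V → W → Prop}
    (hval : ∀ v, Monotone (val v)) {Γ : Set (Formula V)} {φ : Formula V} (h : Proves Γ φ) (w : W)
    (hw : ∀ γ ∈ Γ, Forces val w γ) : Forces val w φ := by
  induction h generalizing w with
  | ax h => exact hw _ h
  | topI => trivial
  | botE _ ih => exact (ih w hw).elim
  | andI _ _ ih₁ ih₂ => exact ⟨ih₁ w hw, ih₂ w hw⟩
  | andE₁ _ ih => exact (ih w hw).1
  | andE₂ _ ih => exact (ih w hw).2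
  | orI₁ _ ih => exact .inl (ih w hw)
  | orI₂ _ ih => exact .inr (ih w hw)
  | orE _ _ _ ih₁ ih₂ ih₃ =>
    rcases ih₁ w hw with h | h
    · exact ih₂ w (Set.forall_mem_insert.2 ⟨h, hw⟩)
    · exact ih₃ w (Set.forall_mem_insert.2 ⟨h, hw⟩)
  | impI _ ih =>
    exact fun u hu h => ih u (Set.forall_mem_insert.2 ⟨h, fun γ hγ => (hw γ hγ).mono hval hu⟩)
  | impE _ _ ih₁ ih₂ => exact ih₁ w hw w le_rfl (ih₂ w hw)

/-- A prime theory: a consistent, deductively closed set of formulas with the disjunction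
property. -/
structure IsPrimeTheory {V : Type} (Δ : Set (Formula V)) : Prop where
  bot_notMem : Formula.bot ∉ Δ
  mem_of_proves {φ : Formula V} : Proves Δ φ → φ ∈ Δ
  mem_or_mem {φ ψ : Formula V} : Formula.or φ ψ ∈ Δ → φ ∈ Δ ∨ ψ ∈ Δ

/-- A set of formulas that is maximal among those not proving `φ` is a prime theory. -/
theorem exists_isPrimeTheory {V : Type} {Γ : Set (Formula V)} {φ : Formula V}
    (h : ¬ Proves Γ φ) : ∃ Δ, Γ ⊆ Δ ∧ IsPrimeTheory Δ ∧ φ ∉ Δ := by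
  obtain ⟨Δ, hΓ, hΔ⟩ := zorn_subset_nonempty {Δ : Set (Formula V) | ¬ Proves Δ φ}
    (fun c hc hchain hne => ⟨⋃₀ c, fun hp => by
      obtain ⟨Δ, hsub, hfin, hp⟩ := hp.exists_finite
      obtain ⟨s, hs, hΔs⟩ := hchain.directedOn.exists_mem_subset_of_finite_of_subset_sUnion
        hne hfin hsub
      exact hc hs (hp.mono hΔs), fun _ => Set.subset_sUnion_of_mem⟩) Γ h
  have hnot : ¬ Proves Δ φ := hΔ.prop
  have key {ψ : Formula V} (hψ : ψ ∉ Δ) : Proves (insert ψ Δ) φ := by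
    by_contra hn
    exact hψ (hΔ.le_of_ge hn (Set.subset_insert _ _) (Set.mem_insert _ _))
  refine ⟨Δ, hΓ, ⟨fun hb => hnot (.botE (.ax hb)), fun {ψ} hψ => ?_, fun {ψ χ} hor => ?_⟩,
    fun hφ => hnot (.ax hφ)⟩
  · by_contra hn
    exact hnot (hψ.cut (key hn))
  · by_contra! hn
    exact hnot (.orE (.ax hor) (key hn.1) (key hn.2))

/-- The worlds of the canonical model, ordered by inclusion. -/
abbrev PrimeTheory (V : Type) : Type := {Δ : Set (Formula V) // IsPrimeTheory Δ}

theorem forces_primeTheory {V : Type} (w : PrimeTheory V) (φ : Formula V) :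
    Forces (fun v (w : PrimeTheory V) => Formula.var v ∈ w.1) w φ ↔ φ ∈ w.1 := by
  induction φ generalizing w with
  | var v => exact Iff.rfl
  | bot => exact ⟨False.elim, w.2.bot_notMem⟩
  | top => exact ⟨fun _ => w.2.mem_of_proves .topI, fun _ => trivial⟩
  | and φ ψ ih₁ ih₂ =>
    simp only [Forces, ih₁, ih₂]
    exact ⟨fun h => w.2.mem_of_proves (.andI (.ax h.1) (.ax h.2)),
      fun h => ⟨w.2.mem_of_proves (.andE₁ (.ax h)), w.2.mem_of_proves (.andE₂ (.ax h))⟩⟩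
  | or φ ψ ih₁ ih₂ =>
    simp only [Forces, ih₁, ih₂]
    exact ⟨fun h => w.2.mem_of_proves (h.elim (fun h => .orI₁ (.ax h)) fun h => .orI₂ (.ax h)),
      w.2.mem_or_mem⟩
  | imp φ ψ ih₁ ih₂ =>
    simp only [Forces, ih₁, ih₂]
    refine ⟨fun h => ?_, fun h u hu hφ => u.2.mem_of_proves (.impE (.ax (hu h)) (.ax hφ))⟩
    by_contra hn
    have hp : ¬ Proves (insert φ w.1) ψ := fun hp => hn (w.2.mem_of_proves (.impI hp))
    obtain ⟨Δ, hsub, hΔ, hψ⟩ := exists_isPrimeTheory hp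
    exact hψ (h ⟨Δ, hΔ⟩ ((Set.subset_insert _ _).trans hsub) (hsub (Set.mem_insert _ _)))

/-- Strong completeness of intuitionistic logic for Kripke models. -/
theorem exists_countermodel {V : Type} {Γ : Set (Formula V)} {φ : Formula V}
    (h : ¬ Proves Γ φ) : ∃ (W : Type) (_ : Preorder W) (val : V → W → Prop) (w : W),
      (∀ v, Monotone (val v)) ∧ (∀ γ ∈ Γ, Forces val w γ) ∧ ¬ Forces val w φ := by
  obtain ⟨Δ, hsub, hΔ, hφ⟩ := exists_isPrimeTheory h
  exact ⟨PrimeTheory V, inferInstance, fun v w => Formula.var v ∈ w.1, ⟨Δ, hΔ⟩,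
    fun v w u hwu hv => hwu hv, fun γ hγ => (forces_primeTheory _ γ).2 (hsub hγ),
    fun hf => hφ ((forces_primeTheory _ φ).1 hf)⟩

/-! ### The translation -/

/-- Formulas for the Rieger–Nishimura ladder. On the ladder `x 0, x 1, …` the components of
`ladder q k` define the sets of all `x j` with `j + 1 < k`, with `j < k`, and with `j = k` or
`j + 2 ≤ k`, respectively; the last is the set of rungs seen from `x k`. -/
def ladder {V : Type} (q : Formula V) : ℕ → Formula V × Formula V × Formula V
  | 0 => (.bot, .bot, q)
  | k + 1 =>
    ((ladder q k).2.1, .or (ladder q k).2.1 (ladder q k).2.2,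
      .imp (ladder q k).2.2 (ladder q k).1)

/-- The formula `A i` standing for the `i`-th variable. It fails at a world seeing exactly the
rungs `x 0, …, x i` of the ladder and not lying on it. -/
def code {V : Type} (p q : Formula V) (i : ℕ) : Formula V :=
  .imp (.imp p (ladder q (i + 1)).2.1) (.or p (.imp p (ladder q i).2.1))

/-- The formula `b = q ∨ (q → p)` standing for `⊥`. -/
def base {V : Type} (p q : Formula V) : Formula V := .or q (.imp q p)

/-- The translation of formulas over `V`, with variables enumerated by `idx`, into formulas built
from `p` and `q`, with all values below `t`. The conjunct `t` is added only where it is not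
inherited from subformulas, so that `∧` and `∨` are preserved literally. -/
def translate {V V' : Type} (idx : V → ℕ) (p q t : Formula V') : Formula V → Formula V'
  | .var v => .and (.or (code p q (idx v)) (base p q)) t
  | .bot => .and (base p q) t
  | .top => t
  | .and φ ψ => .and (translate idx p q t φ) (translate idx p q t ψ)
  | .or φ ψ => .or (translate idx p q t φ) (translate idx p q t ψ)
  | .imp φ ψ => .and (.imp (translate idx p q t φ) (translate idx p q t ψ)) t

section Preservation

variable {V V' : Type} (idx : V → ℕ) (p q t : Formula V')

theorem proves_of_proves_translate (φ : Formula V) {Δ : Set (Formula V')}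
    (h : Proves Δ (translate idx p q t φ)) : Proves Δ t := by
  induction φ generalizing Δ with
  | var v => exact .andE₂ h
  | bot => exact .andE₂ h
  | top => exact h
  | and φ ψ ih₁ _ => exact ih₁ (.andE₁ h)
  | or φ ψ ih₁ ih₂ =>
    exact .orE h (ih₁ (.ax (Set.mem_insert _ _))) (ih₂ (.ax (Set.mem_insert _ _)))
  | imp φ ψ _ _ => exact .andE₂ h

theorem proves_translate_of_proves_base (φ : Formula V) {Δ : Set (Formula V')}
    (hb : Proves Δ (base p q)) (ht : Proves Δ t) : Proves Δ (translate idx p q t φ) := by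
  induction φ generalizing Δ with
  | var v => exact .andI (.orI₂ hb) ht
  | bot => exact .andI hb ht
  | top => exact ht
  | and φ ψ ih₁ ih₂ => exact .andI (ih₁ hb ht) (ih₂ hb ht)
  | or φ ψ ih₁ _ => exact .orI₁ (ih₁ hb ht)
  | imp φ ψ _ ih₂ =>
    exact .andI (.impI (ih₂ (hb.mono (Set.subset_insert _ _)) (ht.mono (Set.subset_insert _ _)))) ht

theorem Proves.translate {Γ : Set (Formula V)} {φ : Formula V} (h : Proves Γ φ)
    {Δ : Set (Formula V')} (hΓ : translate idx p q t '' Γ ⊆ Δ) (ht : Proves Δ t) :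
    Proves Δ (translate idx p q t φ) := by
  have image_insert {Γ : Set (Formula V)} {Δ : Set (Formula V')} (φ : Formula V)
      (hΓ : IPC.translate idx p q t '' Γ ⊆ Δ) :
      IPC.translate idx p q t '' (insert φ Γ) ⊆ insert (IPC.translate idx p q t φ) Δ := by
    rw [Set.image_insert_eq]
    exact Set.insert_subset_insert hΓ
  induction h generalizing Δ with
  | ax h => exact .ax (hΓ (Set.mem_image_of_mem _ h))
  | topI => exact ht
  | botE _ ih => exact proves_translate_of_proves_base idx p q t _ (.andE₁ (ih hΓ ht)) ht
  | andI _ _ ih₁ ih₂ => exact .andI (ih₁ hΓ ht) (ih₂ hΓ ht)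
  | andE₁ _ ih => exact .andE₁ (ih hΓ ht)
  | andE₂ _ ih => exact .andE₂ (ih hΓ ht)
  | orI₁ _ ih => exact .orI₁ (ih hΓ ht)
  | orI₂ _ ih => exact .orI₂ (ih hΓ ht)
  | orE _ _ _ ih₁ ih₂ ih₃ =>
    exact .orE (ih₁ hΓ ht) (ih₂ (image_insert _ hΓ) (ht.mono (Set.subset_insert _ _)))
      (ih₃ (image_insert _ hΓ) (ht.mono (Set.subset_insert _ _)))
  | impI _ ih => exact .andI (.impI (ih (image_insert _ hΓ) (ht.mono (Set.subset_insert _ _)))) ht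
  | impE _ _ ih₁ ih₂ => exact .impE (.andE₁ (ih₁ hΓ ht)) (ih₂ hΓ ht)

end Preservation

/-! ### Extending a Kripke model by the ladder -/

/-- The worlds of the extension of a model with set of worlds `W` and variables in `V`. -/
inductive World (V W : Type) : Type where
  /-- A world of the given model. -/
  | old : W → World V W
  /-- The maximal world forcing `q` but not `p`. -/
  | d : World V W
  /-- The world seen where the variable `v` fails. -/
  | c (v : V) : World V W
  /-- A rung of the Rieger–Nishimura ladder. -/
  | x (k : ℕ) : World V W

namespace World

variable {V W : Type}

/-- The order of the extended model. -/
def Sees [Preorder W] (idx : V → ℕ) (val : V → W → Prop) : World V W → World V W → Prop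
  | old w, old u => w ≤ u
  | old _, d => True
  | old w, c v => ¬ val v w
  | old _, x _ => True
  | d, d => True
  | c v, c v' => v = v'
  | c v, x j => j ≤ idx v
  | x k, x j => j = k ∨ j + 2 ≤ k
  | _, _ => False

/-- The extended model as a preorder; reducible, so that unfolding `≤` yields `Sees`. -/
abbrev preorder [Preorder W] (idx : V → ℕ) (val : V → W → Prop) (hval : ∀ v, Monotone (val v)) :
    Preorder (World V W) where
  le := Sees idx val
  le_refl a := by cases a <;> simp [Sees]
  le_trans a b e hab hbe := by
    cases a <;> cases b <;> cases e <;> simp only [Sees] at hab hbe ⊢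
    case old.old.old => exact hab.trans hbe
    case old.old.c => exact fun h => hbe (hval _ hab h)
    case old.c.c => exact hbe ▸ hab
    case c.c.c => exact hab.trans hbe
    case c.c.x => exact hab ▸ hbe
    all_goals omega

/-- `p` is true exactly on the ladder. -/
def IsP : World V W → Prop
  | x _ => True
  | _ => False

/-- `q` is true exactly at `d` and at the first rung `x 0`. -/
def IsQ : World V W → Prop
  | d => True
  | x k => k = 0
  | _ => False

end World

section Reflection

open World

variable {V V' W : Type} [Preorder W] {idx : V → ℕ} {val : V → W → Prop}
  {hval : ∀ v, Monotone (val v)} {val' : V' → World V W → Prop} {p q t : Formula V'}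

theorem forces_ladder (hq : ∀ a, @Forces _ _ (World.preorder idx val hval) val' a q ↔ IsQ a)
    (k j : ℕ) :
    (@Forces _ _ (World.preorder idx val hval) val' (x j) (ladder q k).1 ↔ j + 1 < k) ∧
    (@Forces _ _ (World.preorder idx val hval) val' (x j) (ladder q k).2.1 ↔ j < k) ∧
    (@Forces _ _ (World.preorder idx val hval) val' (x j) (ladder q k).2.2 ↔
      j = k ∨ j + 2 ≤ k) := by
  induction k generalizing j with
  | zero => simp [ladder, Forces, hq, IsQ]
  | succ k ih =>
    simp only [ladder, Forces, (ih _).2.1, (ih _).2.2]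
    refine ⟨by omega, by omega, fun h => ?_, fun h u hu hf => ?_⟩
    · -- A rung other than those listed sees `x k`, which lies outside the conclusion.
      by_contra hn
      have := (ih k).1.1 (h (x k) (show k = j ∨ k + 2 ≤ j by omega)
        ((ih k).2.2.2 (.inl rfl)))
      omega
    · cases u with
      | x i =>
        have hu : i = j ∨ i + 2 ≤ j := hu
        exact (ih i).1.2 (by have := (ih i).2.2.1 hf; omega)
      | _ => exact hu.elim

/-- A formula `p → E`, with `E` an initial segment of the ladder, is tested on the visible
rungs. -/
theorem forces_imp_ladder
    (hp : ∀ a, @Forces _ _ (World.preorder idx val hval) val' a p ↔ IsP a)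
    (hq : ∀ a, @Forces _ _ (World.preorder idx val hval) val' a q ↔ IsQ a)
    (k : ℕ) (a : World V W) :
    @Forces _ _ (World.preorder idx val hval) val' a (.imp p (ladder q k).2.1) ↔
      ∀ j, Sees idx val a (x j) → j < k := by
  simp only [Forces, hp]
  constructor
  · exact fun h j hj => (forces_ladder hq k j).2.1.1 (h (x j) hj trivial)
  · intro h u hu hpu
    cases u with
    | x j => exact (forces_ladder hq k j).2.1.2 (h j hu)
    | _ => exact hpu.elim

theorem forces_code (hidx : Function.Injective idx)
    (hp : ∀ a, @Forces _ _ (World.preorder idx val hval) val' a p ↔ IsP a)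
    (hq : ∀ a, @Forces _ _ (World.preorder idx val hval) val' a q ↔ IsQ a)
    (v : V) (w : W) :
    @Forces _ _ (World.preorder idx val hval) val' (old w) (code p q (idx v)) ↔ val v w := by
  let := World.preorder idx val hval
  change (∀ a, old w ≤ a → Forces val' a (.imp p (ladder q (idx v + 1)).2.1) →
    Forces val' a p ∨ Forces val' a (.imp p (ladder q (idx v)).2.1)) ↔ _
  simp only [forces_imp_ladder hp hq, hp]
  constructor
  · intro h
    by_contra hn
    rcases h (c v) hn (fun j hj => Nat.lt_succ_of_le hj) with h | h
    · exact h
    · exact lt_irrefl _ (h (idx v) (le_refl (idx v)))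
  · intro hv a ha h
    cases a with
    | old u => exact absurd (h (idx v + 1) trivial) (lt_irrefl _)
    | d => exact .inr fun j hj => hj.elim
    | x k => exact .inl trivial
    | c v' =>
      have hne : idx v' ≠ idx v := fun he => ha (hidx he ▸ hv)
      refine .inr fun j hj => ?_
      have hj : j ≤ idx v' := hj
      have := h (idx v') (le_refl (idx v'))
      omega

theorem forces_base
    (hp : ∀ a, @Forces _ _ (World.preorder idx val hval) val' a p ↔ IsP a)
    (hq : ∀ a, @Forces _ _ (World.preorder idx val hval) val' a q ↔ IsQ a) (a : World V W) :
    @Forces _ _ (World.preorder idx val hval) val' a (base p q) ↔ ∀ w, a ≠ old w := by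
  simp only [base, Forces, hp, hq]
  cases a with
  | old w =>
    refine iff_of_false ?_ fun h => h w rfl
    rintro (h | h)
    · exact h
    · exact h d trivial trivial
  | d => exact iff_of_true (.inl trivial) (by simp)
  | x k =>
    refine iff_of_true (.inr fun u hu _ => ?_) (by simp)
    cases u with
    | x j => trivial
    | _ => exact hu.elim
  | c v =>
    refine iff_of_true (.inr fun u hu hqu => ?_) (by simp)
    cases u with
    | x j => trivial
    | c v' => exact hqu.elim
    | _ => exact hu.elim

/-- A world of the original model forces a formula iff it forces its translation in the extended
model. -/
theorem forces_translate (hval' : ∀ v, @Monotone _ _ (World.preorder idx val hval) _ (val' v))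
    (hidx : Function.Injective idx)
    (hp : ∀ a, @Forces _ _ (World.preorder idx val hval) val' a p ↔ IsP a)
    (hq : ∀ a, @Forces _ _ (World.preorder idx val hval) val' a q ↔ IsQ a)
    (ht : ∀ a, @Forces _ _ (World.preorder idx val hval) val' a t)
    (φ : Formula V) (w : W) :
    @Forces _ _ (World.preorder idx val hval) val' (old w) (translate idx p q t φ) ↔
      Forces val w φ := by
  let := World.preorder idx val hval
  induction φ generalizing w with
  | var v => simp [translate, Forces, forces_code hidx hp hq, forces_base hp hq, ht]
  | bot => simp [translate, Forces, forces_base hp hq]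
  | top => simp [translate, Forces, ht]
  | and φ ψ ih₁ ih₂ => simp [translate, Forces, ih₁, ih₂]
  | or φ ψ ih₁ ih₂ => simp [translate, Forces, ih₁, ih₂]
  | imp φ ψ ih₁ ih₂ =>
    simp only [translate, Forces, ht, and_true]
    constructor
    · exact fun h u hu hφ => (ih₂ u).1 (h (old u) hu ((ih₁ u).2 hφ))
    · intro h a ha hφ
      by_cases hold : ∃ u, a = old u
      · obtain ⟨u, rfl⟩ := hold
        exact (ih₂ u).2 (h u ha ((ih₁ u).1 hφ))
      · -- A new world forces `b`, hence every translated formula.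
        have hb := (forces_base hp hq a).2 (not_exists.1 hold)
        refine (proves_translate_of_proves_base idx p q t ψ (Δ := {base p q, t})
          (.ax (by simp)) (.ax (by simp))).sound hval' a ?_
        simpa using ⟨hb, ht a⟩

end Reflection

/-! ### The two embeddings -/

/-- The formula `¬¬(p ∨ q)`, which is true in the extended models but not a tautology. -/
def notNotOr {V : Type} (p q : Formula V) : Formula V := .imp (.imp (.or p q) .bot) .bot

theorem not_tautology_notNotOr {V : Type} (i j : V) :
    ¬ Tautology (notNotOr (.var i) (.var j)) := by
  -- The countermodel is a single world at which all variables are false.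
  intro h
  have := h.sound (W := Unit) (val := fun _ _ => False) (fun _ _ _ _ => id) () (by simp)
  simp [notNotOr, Forces] at this

theorem andOrPreserving_translate {V V' : Type} (idx : V → ℕ) (p q t : Formula V') :
    AndOrPreserving (translate idx p q t) :=
  fun _ _ => ⟨rfl, rfl⟩

/-- The translation reflects consequence, for both choices of `t`. -/
theorem proves_of_proves_image_translate {V V' : Type} {idx : V → ℕ}
    (hidx : Function.Injective idx) {i j : V'} (hij : i ≠ j) {t : Formula V'}
    (ht : t = .top ∨ t = notNotOr (.var i) (.var j)) {Γ : Set (Formula V)} {φ : Formula V}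
    (h : Proves (translate idx (.var i) (.var j) t '' Γ) (translate idx (.var i) (.var j) t φ)) :
    Proves Γ φ := by
  classical
  by_contra hn
  obtain ⟨W, _, val, w, hval, hΓ, hφ⟩ := exists_countermodel hn
  let := World.preorder idx val hval
  let val' : V' → World V W → Prop := fun k a =>
    if k = i then a.IsP else if k = j then a.IsQ else False
  have hmono : ∀ k, Monotone (val' k) := by
    intro k a b hab
    have hab : World.Sees idx val a b := hab
    simp only [val']
    split_ifs
    · cases a <;> cases b <;> simp_all [World.Sees, World.IsP]
    · cases a <;> cases b <;> simp only [World.Sees, World.IsQ] at hab ⊢ <;> intro h <;>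
        first | exact h.elim | omega
    · exact id
  have hp : ∀ a, Forces val' a (.var i) ↔ a.IsP := fun a => by simp [Forces, val']
  have hq : ∀ a, Forces val' a (.var j) ↔ a.IsQ := fun a => by simp [Forces, val', hij.symm]
  have htop : ∀ a, Forces val' a t := by
    intro a
    rcases ht with rfl | rfl
    · trivial
    · intro b _ hb
      -- Every world sees a world forcing `p` or `q`: the maximal world `d` or a rung `x 0`, `x k`.
      have hb : ∀ a, b ≤ a → a.IsP ∨ a.IsQ → False := fun a ha h =>
        hb a ha (h.imp (hp a).2 (hq a).2)
      cases b with
      | old u => exact hb .d trivial (.inr trivial)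
      | d => exact hb .d trivial (.inr trivial)
      | c v => exact hb (.x 0) (Nat.zero_le (idx v)) (.inl trivial)
      | x k => exact hb (.x k) (.inl rfl) (.inl trivial)
  have key := forces_translate hmono hidx hp hq htop
  exact hφ ((key φ w).1 (h.sound hmono _
    (Set.forall_mem_image.2 fun γ hγ => (key γ w).2 (hΓ γ hγ))))

theorem consequenceRespecting_translate {V V' : Type} {idx : V → ℕ}
    (hidx : Function.Injective idx) {i j : V'} (hij : i ≠ j) {t : Formula V'}
    (ht : t = .top ∨ t = notNotOr (.var i) (.var j)) :
    ConsequenceRespecting (translate idx (.var i) (.var j) t) := by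
  refine fun Γ φ hne => ⟨fun h => ?_, proves_of_proves_image_translate hidx hij ht⟩
  obtain ⟨γ, hγ⟩ := hne
  -- The conjunct `t` comes from any translated premise; this is where `Γ` must be nonempty.
  exact h.translate idx _ _ t subset_rfl
    (proves_of_proves_translate idx _ _ t γ (.ax (Set.mem_image_of_mem _ hγ)))

theorem tautologyRespecting_translate {V V' : Type} {idx : V → ℕ}
    (hidx : Function.Injective idx) {i j : V'} (hij : i ≠ j) :
    TautologyRespecting (translate idx (.var i) (.var j) .top) := by
  refine fun φ => ⟨fun h => h.translate idx _ _ _ (by simp) .topI, fun h => ?_⟩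
  exact proves_of_proves_image_translate hidx hij (.inl rfl) (by simpa [Tautology] using h)

end IPC

theorem mainTheorem3 (m : ℕ∞) (n : ℕ) (hn : 2 ≤ n) :
    (∃ f : IPC.F m → IPC.F n,
      IPC.ConsequenceRespecting f ∧ IPC.TautologyRespecting f ∧ IPC.AndOrPreserving f) ∧
    (∃ f : IPC.F m → IPC.F n,
      IPC.ConsequenceRespecting f ∧ IPC.AndOrPreserving f ∧ ¬ IPC.TautologyRespecting f) ∧
    (∃ f : IPC.F m → IPC.F n,
      IPC.ConsequenceRespecting f ∧ IPC.TautologyRespecting f) := by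
  let i : IPC.Var n := ⟨0, by exact_mod_cast (by omega : 0 < n)⟩
  let j : IPC.Var n := ⟨1, by exact_mod_cast (by omega : 1 < n)⟩
  have hij : i ≠ j := fun h => zero_ne_one (congrArg Subtype.val h)
  let idx : IPC.Var m → ℕ := Subtype.val
  have hidx : Function.Injective idx := Subtype.val_injective
  have hcons := IPC.consequenceRespecting_translate hidx hij (.inl rfl)
  have htaut := IPC.tautologyRespecting_translate hidx hij
  refine ⟨⟨_, hcons, htaut, IPC.andOrPreserving_translate _ _ _ _⟩, ?_, ⟨_, hcons, htaut⟩⟩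
  refine ⟨_, IPC.consequenceRespecting_translate hidx hij (.inr rfl),
    IPC.andOrPreserving_translate _ _ _ _, fun h => IPC.not_tautology_notNotOr i j ?_⟩
  -- The tautology `⊤` is translated to `¬¬(p ∨ q)`.
  exact (h .top).1 .topI
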